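/- Let $\mathbf{U} \in \mathbf{U}^+$ be universes and let $\kappa, \lambda$ be regular cardinals in $\mathbf{U}$. An object $X$ of a category is $(\kappa,\mathbf{U})$-compact if $\mathrm{Hom}(X,-)$ preserves colimits of $\mathbf{U}$-small $\kappa$-filtered diagrams. A $\kappa$-accessible $\mathbf{U}$-category is a locally $\mathbf{U}$-small category that has colimits of $\mathbf{U}$-small $\kappa$-filtered diagrams and a $\mathbf{U}$-small set of $(\kappa,\mathbf{U})$-compact objects such that every object is a colimit of a $\mathbf{U}$-small $\kappa$-filtered diagram of these; it is a locally $\kappa$-presentable $\mathbf{U}$-category if moreover it has colimits of all $\mathbf{U}$-small diagrams. A $(\kappa,\mathbf{U},\mathbf{U}^+)$-accessible extension is a functor $i : \mathcal{C} \to \mathcal{C}^+$ from a $\kappa$-accessible $\mathbf{U}$-category to a $\kappa$-accessible $\mathbf{U}^+$-category that preserves colimits of $\mathbf{U}$-small $\kappa$-filtered diagrams, sends $(\kappa,\mathbf{U})$-compact objects to $(\kappa,\mathbf{U}^+)$-compact objects, and induces a fully faithful and essentially surjective functor between the full subcategories of $(\kappa,\mathbf{U})$-compact objects of $\mathcal{C}$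 and of $(\kappa,\mathbf{U}^+)$-compact objects of $\mathcal{C}^+$. Let $\mathcal{C}$ be a locally $\kappa$-presentable $\mathbf{U}$-category, $\mathcal{D}$ a locally $\lambda$-presentable $\mathbf{U}$-category, $\mathcal{C}^+$ a locally $\kappa$-presentable $\mathbf{U}^+$-category and $\mathcal{D}^+$ a locally $\lambda$-presentable $\mathbf{U}^+$-category. Let $i : \mathcal{C} \to \mathcal{C}^+$ be a $(\kappa,\mathbf{U},\mathbf{U}^+)$-accessible extension and $j : \mathcal{D} \to \mathcal{D}^+$ a $(\lambda,\mathbf{U},\mathbf{U}^+)$-accessible extension. Let $\mathcal{A}$ be a category which is a set in some (arbitrary) universe, and let $F : \mathcal{A} \to \mathcal{C}$, $G : \mathcal{A} \to \mathcal{D}$ and $H : \mathcal{C} \to \mathcal{D}$ be functors. (i) If $H$, with counit $\varepsilon : HF \Rightarrow G$, is a pointwise right Kan extension of $G$ along $F$, then $jH$, with counit $j\varepsilon$, is a pointwise right Kan extension of $jG$ along $F$; and if $H^+ : \mathcal{C}^+ \to \mathcal{D}^+$, with counit $\beta : H^+ i \Rightarrow jH$, is a pointwise right Kan extension of $jH$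 along $i$, then $H^+$, with counit $j\varepsilon \circ \beta F$, is also a pointwise right Kan extension of $jG$ along $iF$. (ii) Suppose that $\mathcal{A}$ is $\mathbf{U}$-small, or more generally essentially $\mathbf{U}$-small. If $H$, with unit $\eta : G \Rightarrow HF$, is a pointwise left Kan extension of $G$ along $F$, then $jH$, with unit $j\eta$, is a pointwise left Kan extension of $jG$ along $F$; and if $H^+ : \mathcal{C}^+ \to \mathcal{D}^+$, with unit $\beta : jH \Rightarrow H^+ i$, is a pointwise left Kan extension of $jH$ along $i$, then $H^+$, with unit $\beta F \circ j\eta$, is also a pointwise left Kan extension of $jG$ along $iF$. -/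

import Mathlib

open CategoryTheory Limits

universe w t vA uA vC uC vD uD vC' uC' vD' uD'

/-- A regular cardinal in a universe remains a regular cardinal in any larger universe. -/
instance Cardinal.fact_isRegular_lift (κ : Cardinal.{w}) [hκ : Fact κ.IsRegular] :
    Fact (Cardinal.lift.{t, w} κ).IsRegular :=
  ⟨hκ.out.lift⟩

namespace CategoryTheory.Functor

section Accessible

universe v v' u u'

variable {C : Type u} [Category.{v} C] {C' : Type u'} [Category.{v'} C']

/-- If `i` sends `(κ, U)`-compact objects to `(κ, U⁺)`-compact objects, this is the functor
`K_κ^U(C) ⥤ K_κ^{U⁺}(C')` that it induces between the full subcategories of such objects.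
Here `U` is `Type w` and `U⁺` is `Type (max w t)`. -/
abbrev onCompact (κ : Cardinal.{w}) [Fact κ.IsRegular] (i : C ⥤ C')
    (hi : ∀ X : C, isCardinalPresentable C κ X →
      isCardinalPresentable C' (Cardinal.lift.{t} κ) (i.obj X)) :
    (isCardinalPresentable C κ).FullSubcategory ⥤
      (isCardinalPresentable C' (Cardinal.lift.{t} κ)).FullSubcategory :=
  ObjectProperty.lift _ ((isCardinalPresentable C κ).ι ⋙ i) (fun X => hi X.obj X.property)

/-- `(κ, U, U⁺)`-accessible extensions, for `U = Type w` and `U⁺ = Type (max w t)`: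
`(κ, U)`-accessible functors `i : C ⥤ C'` from a `κ`-accessible `U`-category to a `κ`-accessible
`U⁺`-category which send `(κ, U)`-compact objects to `(κ, U⁺)`-compact objects, and for which the
functor so induced between the full subcategories of compact objects is fully faithful and
essentially surjective on objects. -/
structure IsAccessibleExtension (κ : Cardinal.{w}) [Fact κ.IsRegular] (i : C ⥤ C') : Prop where
  source : IsCardinalAccessibleCategory C κ
  target : IsCardinalAccessibleCategory C' (Cardinal.lift.{t} κ)
  accessible : i.IsCardinalAccessible κ
  compact : ∀ X : C, isCardinalPresentable C κ X →
    isCardinalPresentable C' (Cardinal.lift.{t} κ) (i.obj X)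
  full : (onCompact.{w, t} κ i compact).Full
  faithful : (onCompact.{w, t} κ i compact).Faithful
  essSurj : (onCompact.{w, t} κ i compact).EssSurj

end Accessible

section Kan

variable {A C D : Type*} [Category* A] [Category* C] [Category* D]

/-- `H`, with the counit `ε : F ⋙ H ⟶ G`, is a pointwise right Kan extension of `G` along `F`:
each `H.obj X` is the limit of `G` over the comma category `(X ↓ F)`, via `ε`. -/
def IsPointwiseRan (F : A ⥤ C) (G : A ⥤ D) (H : C ⥤ D) (ε : F ⋙ H ⟶ G) : Prop :=
  Nonempty (RightExtension.mk H ε).IsPointwiseRightKanExtension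

/-- `H`, with the unit `η : G ⟶ F ⋙ H`, is a pointwise left Kan extension of `G` along `F`:
each `H.obj X` is the colimit of `G` over the comma category `(F ↓ X)`, via `η`. -/
def IsPointwiseLan (F : A ⥤ C) (G : A ⥤ D) (H : C ⥤ D) (η : G ⟶ F ⋙ H) : Prop :=
  Nonempty (LeftExtension.mk H η).IsPointwiseLeftKanExtension

end Kan

end CategoryTheory.Functor

namespace CategoryTheory

/-! A pointwise Kan extension is computed objectwise by limits or colimits over comma categories,
and pointwise Kan extensions compose. So everything reduces to `j` preserving limits over `X ↓ F`,
whatever their size, and colimits over `F ↓ X`, which is essentially U-small when `A` is.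

Limits: for `K` compact, Hom(iK, iX) = Hom(K, X) for every `X` (`exists_map_eq`, `map_injective`),
and the `iK` are dense in the target (`isDense`). Cones over `iT` can thus be tested on the `iK`,
where they are cones over `T`.

Colimits: a cocone with vertex `Y` under a U-small `iT` involves, up to isomorphism, a U-small set
of objects `iK ⟶ Y` with `K` compact. Closing it under κ-small colimits gives an essentially U-small
κ-filtered category whose colimit `Z` in the source is preserved by `i`. The cocone then factors
through `iZ ⟶ Y` as the image of a cocone under `T` with vertex `Z` (`exists_lift`). -/

theorem IsCardinalFiltered.lift {J : Type*} [Category* J] (κ : Cardinal.{w}) [Fact κ.IsRegular]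
    [IsCardinalFiltered J κ] : IsCardinalFiltered J (Cardinal.lift.{t} κ) where
  nonempty_cocone F hA := ⟨IsCardinalFiltered.cocone F ((hasCardinalLT_lift_iff _ κ).1 hA)⟩

theorem EssentiallySmall.max (J : Type*) [Category* J] [EssentiallySmall.{w} J] :
    EssentiallySmall.{max w t} J :=
  (essentiallySmall_congr (equivSmallModel.{w} J)).2
    (essentiallySmallSelf.{t} (SmallModel.{w} J))

namespace Functor

/-! ### Composition and preservation of pointwise Kan extensions. -/

section Kan

variable {A C D : Type*} [Category* A] [Category* C] [Category* D]
  {F : A ⥤ C} {G : A ⥤ D} {H : C ⥤ D}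

/-- Elementary form of the universal property of a pointwise right Kan extension. -/
theorem isPointwiseRan_iff {ε : F ⋙ H ⟶ G} :
    IsPointwiseRan F G H ε ↔ ∀ (X : C) (T : D) (φ : ∀ a : A, (X ⟶ F.obj a) → (T ⟶ G.obj a)),
      (∀ (a b : A) (f : a ⟶ b) (x : X ⟶ F.obj a), φ a x ≫ G.map f = φ b (x ≫ F.map f)) →
      ∃! l : T ⟶ H.obj X, ∀ (a : A) (x : X ⟶ F.obj a), l ≫ H.map x ≫ ε.app a = φ a x := by
  constructor
  · rintro ⟨h⟩ X T φ hφ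
    let s : Cone (StructuredArrow.proj X F ⋙ G) :=
      { pt := T
        π :=
          { app := fun y => φ y.right y.hom
            naturality := fun y z f => by
              have := hφ _ _ f.right y.hom
              rw [StructuredArrow.w f] at this
              exact (Category.id_comp _).trans this.symm } }
    refine ⟨(h X).lift s, fun a x => (h X).fac s (StructuredArrow.mk x), fun l hl => ?_⟩
    exact (h X).uniq s l fun y => hl y.right y.hom
  · intro h
    refine ⟨fun X => IsLimit.ofExistsUnique fun s => ?_⟩
    obtain ⟨l, hl, hu⟩ := h X s.pt (fun a x => s.π.app (StructuredArrow.mk x))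
      (fun a b f x => s.w (StructuredArrow.homMk f : StructuredArrow.mk x ⟶
        StructuredArrow.mk (x ≫ F.map f)))
    exact ⟨l, fun y => hl y.right y.hom, fun m hm => hu m fun a x => hm (StructuredArrow.mk x)⟩

/-- Elementary form of the universal property of a pointwise left Kan extension. -/
theorem isPointwiseLan_iff {η : G ⟶ F ⋙ H} :
    IsPointwiseLan F G H η ↔ ∀ (X : C) (T : D) (φ : ∀ a : A, (F.obj a ⟶ X) → (G.obj a ⟶ T)),
      (∀ (a b : A) (f : a ⟶ b) (x : F.obj b ⟶ X), G.map f ≫ φ b x = φ a (F.map f ≫ x)) →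
      ∃! l : H.obj X ⟶ T, ∀ (a : A) (x : F.obj a ⟶ X), η.app a ≫ H.map x ≫ l = φ a x := by
  constructor
  · rintro ⟨h⟩ X T φ hφ
    let s : Cocone (CostructuredArrow.proj F X ⋙ G) :=
      { pt := T
        ι :=
          { app := fun y => φ y.left y.hom
            naturality := fun y z f => by
              have := hφ _ _ f.left z.hom
              rw [CostructuredArrow.w f] at this
              exact this.trans (Category.comp_id _).symm } }
    refine ⟨(h X).desc s, fun a x => ?_, fun l hl => ?_⟩
    · exact (Category.assoc _ _ _).symm.trans ((h X).fac s (CostructuredArrow.mk x))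
    · exact (h X).uniq s l fun y =>
        (Category.assoc _ _ _).trans (hl y.left y.hom)
  · intro h
    refine ⟨fun X => IsColimit.ofExistsUnique fun s => ?_⟩
    obtain ⟨l, hl, hu⟩ := h X s.pt (fun a x => s.ι.app (CostructuredArrow.mk x))
      (fun a b f x => s.w (CostructuredArrow.homMk f : CostructuredArrow.mk (F.map f ≫ x) ⟶
        CostructuredArrow.mk x))
    exact ⟨l, fun y => (Category.assoc _ _ _).trans (hl y.left y.hom),
      fun m hm => hu m fun a x =>
        (Category.assoc _ _ _).symm.trans (hm (CostructuredArrow.mk x))⟩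

variable {C' : Type*} [Category* C'] {i : C ⥤ C'} {H' : C' ⥤ D}

/-- For each fixed `x : X ⟶ i.obj c`, the universal property of `H` collects the family into one map
`T ⟶ H.obj c`; uniqueness makes these maps compatible in `c`, so that of `H'` applies. -/
theorem IsPointwiseRan.comp {ε : F ⋙ H ⟶ G} (hε : IsPointwiseRan F G H ε)
    {β : i ⋙ H' ⟶ H} (hβ : IsPointwiseRan i H H' β) :
    IsPointwiseRan (F ⋙ i) G H' ((associator F i H').hom ≫ whiskerLeft F β ≫ ε) := by
  rw [isPointwiseRan_iff] at hε hβ ⊢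
  intro X T φ hφ
  have key (c : C) (x : X ⟶ i.obj c) := hε c T (fun a y => φ a (x ≫ i.map y))
    (fun a b f y => by simpa using hφ a b f (x ≫ i.map y))
  choose ψ hψ hψu using key
  dsimp only at hψ hψu
  obtain ⟨l, hl, hlu⟩ := hβ X T ψ (fun c d f x => hψu d _ _ fun a y => by
    have := hψ c x a (f ≫ y)
    simpa using this)
  refine ⟨l, fun a x => ?_, fun m hm => hlu m fun c x => hψu c x _ fun a y => ?_⟩
  · have h₁ := hψ (F.obj a) x a (𝟙 _)
    rw [← hl] at h₁
    simpa using h₁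
  · have := β.naturality y =≫ ε.app a
    simp only [comp_map, Category.assoc] at this
    simp [← this, ← hm]

theorem IsPointwiseLan.comp {η : G ⟶ F ⋙ H} (hη : IsPointwiseLan F G H η)
    {β : H ⟶ i ⋙ H'} (hβ : IsPointwiseLan i H H' β) :
    IsPointwiseLan (F ⋙ i) G H' (η ≫ whiskerLeft F β ≫ (associator F i H').inv) := by
  rw [isPointwiseLan_iff] at hη hβ ⊢
  intro X T φ hφ
  have key (c : C) (x : i.obj c ⟶ X) := hη c T (fun a y => φ a (i.map y ≫ x))
    (fun a b f y => by simpa using hφ a b f (i.map y ≫ x))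
  choose ψ hψ hψu using key
  dsimp only at hψ hψu
  obtain ⟨l, hl, hlu⟩ := hβ X T ψ (fun c d f x => hψu c _ _ fun a y => by
    have := hψ d x a (y ≫ f)
    simpa using this)
  refine ⟨l, fun a x => ?_, fun m hm => hlu m fun c x => hψu c x _ fun a y => ?_⟩
  · have h₁ := hψ (F.obj a) x a (𝟙 _)
    rw [← hl] at h₁
    simpa using h₁
  · simp [← hm]

variable {D' : Type*} [Category* D'] (j : D ⥤ D')

theorem IsPointwiseRan.postcomp {ε : F ⋙ H ⟶ G} (hε : IsPointwiseRan F G H ε)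
    [h : ∀ X : C, PreservesLimitsOfShape (StructuredArrow X F) j] :
    IsPointwiseRan F (G ⋙ j) (H ⋙ j) ((associator F H j).inv ≫ whiskerRight ε j) :=
  ⟨fun X => IsLimit.ofIsoLimit (isLimitOfPreserves j (hε.some X))
    (Cone.ext (Iso.refl _) fun y =>
      (by simp : j.map (H.map y.hom ≫ ε.app y.right) =
        𝟙 _ ≫ j.map (H.map y.hom) ≫ (𝟙 _ ≫ j.map (ε.app y.right))))⟩

theorem IsPointwiseLan.postcomp {η : G ⟶ F ⋙ H} (hη : IsPointwiseLan F G H η)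
    [h : ∀ X : C, PreservesColimitsOfShape (CostructuredArrow F X) j] :
    IsPointwiseLan F (G ⋙ j) (H ⋙ j) (whiskerRight η j ≫ (associator F H j).hom) :=
  ⟨fun X => IsColimit.ofIsoColimit (isColimitOfPreserves j (hη.some X))
    (Cocone.ext (Iso.refl _) fun y =>
      (by simp : j.map (η.app y.left ≫ H.map y.hom) ≫ 𝟙 _ =
        (j.map (η.app y.left) ≫ 𝟙 _) ≫ j.map (H.map y.hom)))⟩

end Kan

end Functor

end CategoryTheory

/-! ### Density of compact objects and preservation of limits. -/

namespace CategoryTheory.Functor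

/-- The tautological cocone with point `X` over the objects of the form `Φ.obj K` above `X`. -/
@[simps]
def canonicalCocone {K C : Type*} [Category* K] [Category* C] (Φ : K ⥤ C) (X : C) :
    Cocone (CostructuredArrow.proj Φ X ⋙ Φ) where
  pt := X
  ι :=
    { app := fun k => k.hom
      naturality := fun _ _ f => (CostructuredArrow.w f).trans (Category.comp_id _).symm }

/-- The canonical cocones of a dense functor are colimits. -/
noncomputable def isColimitCanonicalCocone {K C : Type*} [Category* K] [Category* C] (Φ : K ⥤ C)
    [Φ.IsDense] (X : C) : IsColimit (Φ.canonicalCocone X) :=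
  IsColimit.ofIsoColimit (Φ.denseAt X) (Cocone.ext (Iso.refl _) fun k =>
    (by simp : (𝟙 (Φ.obj k.left) ≫ k.hom) ≫ 𝟙 X = k.hom))

namespace IsAccessibleExtension

universe v v' u u'

variable {C : Type u} [Category.{v} C] {C' : Type u'} [Category.{v'} C'] {κ : Cardinal.{w}}
  [Fact κ.IsRegular] {i : C ⥤ C'}

section

variable (hi : IsAccessibleExtension.{w, t} κ i)
include hi

theorem preservesColimitsOfShape_of_isCardinalFiltered (J : Type*) [Category* J]
    [EssentiallySmall.{w} J] [IsCardinalFiltered J κ] : PreservesColimitsOfShape J i :=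
  have := hi.accessible
  i.preservesColimitsOfShape_of_isCardinalAccessible_of_essentiallySmall κ J

theorem exists_map_eq_of_isCardinalPresentable {K L : C} (hK : isCardinalPresentable C κ K)
    (hL : isCardinalPresentable C κ L) (g : i.obj K ⟶ i.obj L) : ∃ f : K ⟶ L, i.map f = g := by
  have := hi.full
  let K' : (isCardinalPresentable C κ).FullSubcategory := ⟨K, hK⟩
  let L' : (isCardinalPresentable C κ).FullSubcategory := ⟨L, hL⟩
  let g' : (onCompact.{w, t} κ i hi.compact).obj K' ⟶ (onCompact.{w, t} κ i hi.compact).obj L' :=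
    ⟨g⟩
  obtain ⟨f, hf⟩ := (onCompact.{w, t} κ i hi.compact).map_surjective g'
  exact ⟨f.hom, congr_arg (fun k => k.hom) hf⟩

theorem map_injective_of_isCardinalPresentable {K L : C} (hK : isCardinalPresentable C κ K)
    (hL : isCardinalPresentable C κ L) {f g : K ⟶ L} (h : i.map f = i.map g) : f = g := by
  have := hi.faithful
  have := (onCompact.{w, t} κ i hi.compact).map_injective
    (X := ⟨K, hK⟩) (Y := ⟨L, hL⟩) (a₁ := ObjectProperty.homMk f) (a₂ := ObjectProperty.homMk g)
    (by ext; exact h)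
  exact congr_arg (fun k => k.hom) this

theorem locallySmall : LocallySmall.{w} C :=
  have := hi.source
  inferInstance

theorem essentiallySmall_costructuredArrow (X : C) :
    EssentiallySmall.{w} (CostructuredArrow (isCardinalPresentable C κ).ι X) :=
  have := hi.source
  inferInstance

theorem isCardinalFiltered_costructuredArrow (X : C) :
    IsCardinalFiltered (CostructuredArrow (isCardinalPresentable C κ).ι X) κ :=
  have := hi.source
  inferInstance

/-- The image under an accessible extension of the canonical presentation of an object as a
filtered colimit of compact objects. -/
theorem nonempty_isColimit (X : C) :
    Nonempty (IsColimit (i.mapCocone ((isCardinalPresentable C κ).ι.canonicalCocone X))) :=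
  have := hi.source
  have := hi.essentiallySmall_costructuredArrow X
  have := hi.preservesColimitsOfShape_of_isCardinalFiltered
    (CostructuredArrow (isCardinalPresentable C κ).ι X)
  ⟨isColimitOfPreserves i ((isCardinalPresentable C κ).ι.isColimitCanonicalCocone X)⟩

theorem hom_ext {X : C} {Y : C'} {f g : i.obj X ⟶ Y}
    (h : ∀ (K : C) (_ : isCardinalPresentable C κ K) (k : K ⟶ X),
      i.map k ≫ f = i.map k ≫ g) : f = g :=
  (hi.nonempty_isColimit X).some.hom_ext fun k => h k.left.obj k.left.property k.hom

theorem source_hom_ext {X Y : C} {f g : X ⟶ Y}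
    (h : ∀ (K : C) (_ : isCardinalPresentable C κ K) (k : K ⟶ X), k ≫ f = k ≫ g) : f = g :=
  have := hi.source
  ((isCardinalPresentable C κ).ι.isColimitCanonicalCocone X).hom_ext fun k =>
    h k.left.obj k.left.property k.hom

theorem exists_source_hom {X Y : C}
    (φ : ∀ K : C, isCardinalPresentable C κ K → (K ⟶ X) → (K ⟶ Y))
    (hφ : ∀ (K L : C) (hK : isCardinalPresentable C κ K) (hL : isCardinalPresentable C κ L)
      (f : K ⟶ L) (k : L ⟶ X), f ≫ φ L hL k = φ K hK (f ≫ k)) :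
    ∃ h : X ⟶ Y, ∀ (K : C) (hK : isCardinalPresentable C κ K) (k : K ⟶ X),
      k ≫ h = φ K hK k := by
  have := hi.source
  let c : Cocone (CostructuredArrow.proj (isCardinalPresentable C κ).ι X ⋙
      (isCardinalPresentable C κ).ι) :=
    { pt := Y
      ι :=
        { app := fun k => φ k.left.obj k.left.property k.hom
          naturality := fun k l f => (hφ _ _ k.left.property l.left.property f.left.hom l.hom).trans
            ((congr_arg (φ _ _) (CostructuredArrow.w f)).trans (Category.comp_id _).symm) } }
  let hX := (isCardinalPresentable C κ).ι.isColimitCanonicalCocone X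
  exact ⟨hX.desc c, fun K hK k => hX.fac c (CostructuredArrow.mk
    (Y := (⟨K, hK⟩ : (isCardinalPresentable C κ).FullSubcategory)) k)⟩

/-- `i.obj X` is a κ-filtered colimit of images of compact objects, so by compactness of `i.obj K`
the map `g` factors through one of them, and fullness on compact objects applies. -/
theorem exists_map_eq {K : C} (hK : isCardinalPresentable C κ K) {X : C}
    (g : i.obj K ⟶ i.obj X) : ∃ f : K ⟶ X, i.map f = g := by
  have := hi.essentiallySmall_costructuredArrow X
  have := hi.isCardinalFiltered_costructuredArrow X
  have := EssentiallySmall.max.{w, t} (CostructuredArrow (isCardinalPresentable C κ).ι X)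
  have := IsCardinalFiltered.lift.{w, t}
    (J := CostructuredArrow (isCardinalPresentable C κ).ι X) κ
  have : IsCardinalPresentable (i.obj K) (Cardinal.lift.{t} κ) := hi.compact K hK
  obtain ⟨k, g', hg'⟩ := IsCardinalPresentable.exists_hom_of_isColimit (Cardinal.lift.{t} κ)
    (hi.nonempty_isColimit X).some g
  obtain ⟨f, rfl⟩ := hi.exists_map_eq_of_isCardinalPresentable hK k.left.property g'
  exact ⟨f ≫ k.hom, (i.map_comp _ _).trans hg'⟩

theorem map_injective {K : C} (hK : isCardinalPresentable C κ K) {X : C} {f g : K ⟶ X}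
    (h : i.map f = i.map g) : f = g := by
  have := hi.essentiallySmall_costructuredArrow X
  have := hi.isCardinalFiltered_costructuredArrow X
  have := EssentiallySmall.max.{w, t} (CostructuredArrow (isCardinalPresentable C κ).ι X)
  have := IsCardinalFiltered.lift.{w, t}
    (J := CostructuredArrow (isCardinalPresentable C κ).ι X) κ
  have : IsCardinalPresentable (i.obj K) (Cardinal.lift.{t} κ) := hi.compact K hK
  let K' : (isCardinalPresentable C κ).FullSubcategory := ⟨K, hK⟩
  let kf : CostructuredArrow (isCardinalPresentable C κ).ι X :=
    CostructuredArrow.mk (Y := K') f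
  let kg : CostructuredArrow (isCardinalPresentable C κ).ι X :=
    CostructuredArrow.mk (Y := K') g
  -- `f` and `g` are themselves stages of the canonical diagram; `h` says that the identity of
  -- `i.obj K`, placed at these two stages, has one image in the colimit.
  obtain ⟨k, a, b, hab⟩ := IsCardinalPresentable.exists_eq_of_isColimit (Cardinal.lift.{t} κ)
    (hi.nonempty_isColimit X).some (i₁ := kf) (i₂ := kg) (𝟙 (i.obj K)) (𝟙 (i.obj K))
    (congr_arg (𝟙 (i.obj K) ≫ ·) h)
  have hab' : a.left.hom = b.left.hom :=
    hi.map_injective_of_isCardinalPresentable hK k.left.property 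
      ((Category.id_comp _).symm.trans (hab.trans (Category.id_comp _)))
  have ha : a.left.hom ≫ k.hom = f := CostructuredArrow.w a
  have hb : b.left.hom ≫ k.hom = g := CostructuredArrow.w b
  rw [← ha, ← hb, hab']

theorem isDense : ((isCardinalPresentable C κ).ι ⋙ i).IsDense := by
  have := hi.target
  have := hi.full
  have := hi.faithful
  have := hi.essSurj
  have : (onCompact.{w, t} κ i hi.compact).IsEquivalence := {}
  exact inferInstanceAs (onCompact.{w, t} κ i hi.compact ⋙
    (isCardinalPresentable C' (Cardinal.lift.{t} κ)).ι).IsDense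

theorem target_hom_ext {X Y : C'} {f g : X ⟶ Y}
    (h : ∀ (K : C) (_ : isCardinalPresentable C κ K) (k : i.obj K ⟶ X), k ≫ f = k ≫ g) :
    f = g :=
  have := hi.isDense
  (((isCardinalPresentable C κ).ι ⋙ i).isColimitCanonicalCocone X).hom_ext fun k =>
    h k.left.obj k.left.property k.hom

theorem exists_target_hom {X Y : C'}
    (φ : ∀ K : C, isCardinalPresentable C κ K → (i.obj K ⟶ X) → (i.obj K ⟶ Y))
    (hφ : ∀ (K L : C) (hK : isCardinalPresentable C κ K) (hL : isCardinalPresentable C κ L)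
      (f : K ⟶ L) (k : i.obj L ⟶ X), i.map f ≫ φ L hL k = φ K hK (i.map f ≫ k)) :
    ∃ h : X ⟶ Y, ∀ (K : C) (hK : isCardinalPresentable C κ K) (k : i.obj K ⟶ X),
      k ≫ h = φ K hK k := by
  have := hi.isDense
  let c : Cocone (CostructuredArrow.proj ((isCardinalPresentable C κ).ι ⋙ i) X ⋙
      (isCardinalPresentable C κ).ι ⋙ i) :=
    { pt := Y
      ι :=
        { app := fun k => φ k.left.obj k.left.property k.hom
          naturality := fun k l f => (hφ _ _ k.left.property l.left.property f.left.hom l.hom).trans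
            ((congr_arg (φ _ _) (CostructuredArrow.w f)).trans (Category.comp_id _).symm) } }
  let hX := ((isCardinalPresentable C κ).ι ⋙ i).isColimitCanonicalCocone X
  exact ⟨hX.desc c, fun K hK k => hX.fac c (CostructuredArrow.mk
    (Y := (⟨K, hK⟩ : (isCardinalPresentable C κ).FullSubcategory)) k)⟩

/-- An accessible extension preserves all limits that exist, whatever their size. -/
theorem preservesLimitsOfShape (J : Type*) [Category* J] : PreservesLimitsOfShape J i where
  preservesLimit {T} := ⟨fun {c} hc => ⟨IsLimit.ofExistsUnique fun s => by
    have key (K : C) (hK : isCardinalPresentable C κ K) (k : i.obj K ⟶ s.pt) :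
        ∃ f : K ⟶ c.pt, ∀ a : J, i.map f ≫ i.map (c.π.app a) = k ≫ s.π.app a := by
      -- A cone with vertex `i.obj K` comes from a cone with vertex `K`, hence factors through `c`.
      choose p hp using fun a => hi.exists_map_eq hK (X := T.obj a) (k ≫ s.π.app a)
      let s' : Cone T :=
        { pt := K
          π :=
            { app := p
              naturality := fun a b f => by
                refine hi.map_injective hK ?_
                have := s.w f
                dsimp at this
                simp [hp, this] } }
      refine ⟨hc.lift s', fun a => ?_⟩
      rw [← i.map_comp, hc.fac s' a]
      exact hp a
    choose φ hφ using key
    have ext' (K : C) (hK : isCardinalPresentable C κ K) (f g : i.obj K ⟶ i.obj c.pt)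
        (h : ∀ a, f ≫ i.map (c.π.app a) = g ≫ i.map (c.π.app a)) : f = g := by
      obtain ⟨f, rfl⟩ := hi.exists_map_eq hK f
      obtain ⟨g, rfl⟩ := hi.exists_map_eq hK g
      congr 1
      exact hc.hom_ext fun a => hi.map_injective hK (by simpa using h a)
    obtain ⟨l, hl⟩ := hi.exists_target_hom (X := s.pt) (Y := i.obj c.pt)
      (fun K hK k => i.map (φ K hK k)) (fun K L hK hL f k => ext' K hK _ _ fun a => by
        rw [hφ, Category.assoc, hφ, Category.assoc])
    refine ⟨l, fun a => hi.target_hom_ext fun K hK k => ?_,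
      fun m hm => hi.target_hom_ext fun K hK k => ?_⟩
    · have := hl K hK k =≫ i.map (c.π.app a)
      rw [hφ, Category.assoc] at this
      exact this
    · rw [hl K hK k]
      refine ext' K hK _ _ fun a => ?_
      rw [hφ, Category.assoc]
      exact congr_arg (k ≫ ·) (hm a)⟩⟩

end

end IsAccessibleExtension

end CategoryTheory.Functor

/-! ### Preservation of small colimits in the locally presentable case. -/

namespace CategoryTheory.Functor.IsAccessibleExtension

universe v v' u u'

variable {C : Type u} [Category.{v} C] {C' : Type u'} [Category.{v'} C'] {κ : Cardinal.{w}}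
  [Fact κ.IsRegular] {i : C ⥤ C'}
  [IsCardinalLocallyPresentable C κ] [IsCardinalLocallyPresentable C' (Cardinal.lift.{t} κ)]
  (hi : IsAccessibleExtension.{w, t} κ i)
include hi

/-- Compact objects are closed under κ-small colimits in both categories, and `i` induces an
equivalence between them; so compact objects of `C` have these colimits, and their functor to `C'`
preserves them. -/
theorem hasColimitsOfShape_costructuredArrow (Y : C') (J : Type w) [SmallCategory J]
    (hJ : HasCardinalLT (Arrow J) κ) :
    HasColimitsOfShape J (CostructuredArrow ((isCardinalPresentable C κ).ι ⋙ i) Y) := by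
  have := hi.full
  have := hi.faithful
  have := hi.essSurj
  have : (onCompact.{w, t} κ i hi.compact).IsEquivalence := {}
  have := isClosedUnderColimitsOfShape_isCardinalPresentable C hJ
  have := isClosedUnderColimitsOfShape_isCardinalPresentable C'
    ((hasCardinalLT_lift_iff _ κ).2 hJ)
  have : HasColimitsOfSize.{w, w} C' := hasColimitsOfSizeShrink.{w, w, max w t, max w t} C'
  have : PreservesColimitsOfShape J (isCardinalPresentable C' (Cardinal.lift.{t} κ)).ι :=
    inferInstance
  have : PreservesColimitsOfShape J ((isCardinalPresentable C κ).ι ⋙ i) :=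
    inferInstanceAs (PreservesColimitsOfShape J (onCompact.{w, t} κ i hi.compact ⋙
      (isCardinalPresentable C' (Cardinal.lift.{t} κ)).ι))
  infer_instance

/-- Every small set of objects above `Y` that come from compact objects is contained in a small
filtered diagram of such objects; its colimit in the source maps to `Y`. -/
theorem exists_cocone_of_essentiallySmall (Y : C')
    (P : ObjectProperty (CostructuredArrow ((isCardinalPresentable C κ).ι ⋙ i) Y))
    [ObjectProperty.EssentiallySmall.{w} P] :
    ∃ (Z : C) (p : i.obj Z ⟶ Y)
      (ι : ∀ k : CostructuredArrow ((isCardinalPresentable C κ).ι ⋙ i) Y, P k → (k.left.obj ⟶ Z)),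
      (∀ k hk, i.map (ι k hk) ≫ p = k.hom) ∧
      ∀ (k l) (hk : P k) (hl : P l) (f : k ⟶ l), f.left.hom ≫ ι l hl = ι k hk := by
  have := hi.locallySmall
  -- The closure is κ-filtered and still essentially small.
  let M := P.colimitsCardinalClosure κ
  have : IsCardinalFiltered M.FullSubcategory κ :=
    { nonempty_cocone := fun {A} _ T hA => by
        have := hi.hasColimitsOfShape_costructuredArrow Y A hA
        have := P.isClosedUnderColimitsOfShape_colimitsCardinalClosure κ A hA
        exact ⟨colimit.cocone T⟩ }
  have : EssentiallySmall.{w} M.FullSubcategory := inferInstance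
  have := hi.preservesColimitsOfShape_of_isCardinalFiltered M.FullSubcategory
  have : HasColimitsOfShape M.FullSubcategory C :=
    hasColimitsOfShape_of_equivalence (equivSmallModel.{w} M.FullSubcategory).symm
  let T : M.FullSubcategory ⥤ C := M.ι ⋙ CostructuredArrow.proj _ _ ⋙
    (isCardinalPresentable C κ).ι
  let c : Cocone (T ⋙ i) :=
    { pt := Y
      ι :=
        { app := fun k => k.obj.hom
          naturality := fun _ _ f =>
            (CostructuredArrow.w f.hom).trans (Category.comp_id _).symm } }
  refine ⟨colimit T, (isColimitOfPreserves i (colimit.isColimit T)).desc c,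
    fun k hk => colimit.ι T ⟨k, P.le_colimitsCardinalClosure κ k hk⟩, fun k hk => ?_,
    fun k l hk hl f => ?_⟩
  · exact (isColimitOfPreserves i (colimit.isColimit T)).fac c
      ⟨k, P.le_colimitsCardinalClosure κ k hk⟩
  · exact colimit.w T (j' := ⟨k, P.le_colimitsCardinalClosure κ k hk⟩)
      (j := ⟨l, P.le_colimitsCardinalClosure κ l hl⟩) (ObjectProperty.homMk f)

/-- A small family of morphisms from objects in the image of `i` to `Y` factors, compatibly with
all the relations that hold between its members, through one object in the image of `i`. -/
theorem exists_lift (Y : C') {S : Type w} (X : S → C) (f : ∀ s, i.obj (X s) ⟶ Y) :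
    ∃ (Z : C) (p : i.obj Z ⟶ Y) (l : ∀ s, X s ⟶ Z), (∀ s, i.map (l s) ≫ p = f s) ∧
      ∀ (s r : S) (W : C) (a : W ⟶ X s) (b : W ⟶ X r), i.map a ≫ f s = i.map b ≫ f r →
        a ≫ l s = b ≫ l r := by
  have (s : S) := hi.essentiallySmall_costructuredArrow (X s)
  let obj (s : S) (k : CostructuredArrow (isCardinalPresentable C κ).ι (X s)) :
      CostructuredArrow ((isCardinalPresentable C κ).ι ⋙ i) Y :=
    CostructuredArrow.mk (Y := k.left) (i.map k.hom ≫ f s)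
  let fam (x : Σ s : S, SmallModel.{w} (CostructuredArrow (isCardinalPresentable C κ).ι (X s))) :
      CostructuredArrow ((isCardinalPresentable C κ).ι ⋙ i) Y :=
    obj x.1 ((equivSmallModel _).inverse.obj x.2)
  let P := (ObjectProperty.ofObj fam).isoClosure
  let ob (s : S) (K : C) (hK : isCardinalPresentable C κ K) (k : K ⟶ X s) :
      CostructuredArrow ((isCardinalPresentable C κ).ι ⋙ i) Y :=
    obj s (CostructuredArrow.mk
      (Y := (⟨K, hK⟩ : (isCardinalPresentable C κ).FullSubcategory)) k)
  have mem (s : S) (K : C) (hK : isCardinalPresentable C κ K) (k : K ⟶ X s) :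
      P (ob s K hK k) := by
    let k' : CostructuredArrow (isCardinalPresentable C κ).ι (X s) := CostructuredArrow.mk
      (Y := (⟨K, hK⟩ : (isCardinalPresentable C κ).FullSubcategory)) k
    let e := (equivSmallModel.{w} _).unitIso.app k'
    refine ⟨_, ObjectProperty.ofObj_apply fam ⟨s, (equivSmallModel _).functor.obj k'⟩,
      ⟨CostructuredArrow.isoMk ((CostructuredArrow.proj _ _).mapIso e) ?_⟩⟩
    have h := CostructuredArrow.w e.hom
    have h' := congr_arg i.map h =≫ f s
    rw [i.map_comp, Category.assoc] at h'
    exact h'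
  obtain ⟨Z, p, ι, hp, hι⟩ := hi.exists_cocone_of_essentiallySmall Y P
  have key (s : S) := hi.exists_source_hom (X := X s) (Y := Z)
    (fun K hK k => ι (ob s K hK k) (mem s K hK k))
    (fun K L hK hL g k => by
      let g' : ob s K hK (g ≫ k) ⟶ ob s L hL k := CostructuredArrow.homMk (ObjectProperty.homMk g)
        (by
          change i.map g ≫ i.map k ≫ f s = i.map (g ≫ k) ≫ f s
          simp)
      exact hι _ _ (mem s K hK (g ≫ k)) (mem s L hL k) g')
  choose l hl using key
  refine ⟨Z, p, l, fun s => hi.hom_ext fun K hK k => ?_, fun s r W a b h =>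
    hi.source_hom_ext fun K hK k => ?_⟩
  · rw [← Category.assoc, ← i.map_comp, hl s K hK k]
    exact hp _ (mem s K hK k)
  · rw [← Category.assoc, ← Category.assoc, hl s K hK, hl r K hK]
    have h' : i.map (k ≫ a) ≫ f s = i.map (k ≫ b) ≫ f r := by simp [h]
    -- By `h'`, the identity of `K` is a morphism between these two objects above `Y`, so `hι`
    -- identifies their maps to `Z`.
    let g : ob s K hK (k ≫ a) ⟶ ob r K hK (k ≫ b) :=
      CostructuredArrow.homMk (𝟙 _) ((by simpa using h'.symm :
        i.map (𝟙 K) ≫ i.map (k ≫ b) ≫ f r = i.map (k ≫ a) ≫ f s))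
    exact (hι _ _ (mem s K hK (k ≫ a)) (mem r K hK (k ≫ b)) g).symm.trans (Category.id_comp _)

/-- An accessible extension of locally presentable categories preserves small colimits. -/
theorem preservesColimitsOfSize : PreservesColimitsOfSize.{w, w} i where
  preservesColimitsOfShape {J _} := ⟨fun {T} => ⟨fun {c} hc =>
    ⟨IsColimit.ofExistsUnique fun s => by
      apply existsUnique_of_exists_of_unique
      · obtain ⟨Z, p, l, hp, hl⟩ := hi.exists_lift s.pt T.obj s.ι.app
        let s' : Cocone T :=
          { pt := Z
            ι :=
              { app := l
                naturality := fun a b f => hl b a (T.obj a) (T.map f) (𝟙 _)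
                  ((s.w f).trans (by simp)) |>.trans (by simp) } }
        refine ⟨i.map (hc.desc s') ≫ p, fun a => ?_⟩
        rw [← hp a]
        change i.map _ ≫ i.map _ ≫ p = _
        rw [← Category.assoc, ← i.map_comp, hc.fac s' a]
      · intro f g hf hg
        -- Lifting `f` and `g` together to maps `c.pt ⟶ Z` turns their agreement on each `T.obj a`
        -- into an equality in `C`, where `c` is a colimit.
        obtain ⟨Z, p, l, hp, hl⟩ := hi.exists_lift s.pt (S := ULift Bool) (fun _ => c.pt)
          (fun x => cond x.down f g)
        have h : l ⟨true⟩ = l ⟨false⟩ := hc.hom_ext fun a =>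
          hl ⟨true⟩ ⟨false⟩ (T.obj a) (c.ι.app a) (c.ι.app a) ((hf a).trans (hg a).symm)
        exact (hp ⟨true⟩).symm.trans ((congr_arg (i.map · ≫ p) h).trans (hp ⟨false⟩))⟩⟩⟩

theorem preservesColimitsOfShape (J : Type*) [Category* J] [EssentiallySmall.{w} J] :
    PreservesColimitsOfShape J i :=
  have := hi.preservesColimitsOfSize
  preservesColimitsOfShape_of_equiv (equivSmallModel.{w} J).symm i

end CategoryTheory.Functor.IsAccessibleExtension

theorem mainTheorem7
    {A : Type uA} [Category.{vA} A]
    {C : Type uC} [Category.{vC} C] {D : Type uD} [Category.{vD} D]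
    {C' : Type uC'} [Category.{vC'} C'] {D' : Type uD'} [Category.{vD'} D']
    (κ lam : Cardinal.{w}) [Fact κ.IsRegular] [Fact lam.IsRegular]
    [IsCardinalLocallyPresentable C κ] [IsCardinalLocallyPresentable D lam]
    [IsCardinalLocallyPresentable C' (Cardinal.lift.{max (w + 1) t} κ)]
    [IsCardinalLocallyPresentable D' (Cardinal.lift.{max (w + 1) t} lam)]
    (i : C ⥤ C') (hi : Functor.IsAccessibleExtension.{w, max (w + 1) t} κ i)
    (j : D ⥤ D') (hj : Functor.IsAccessibleExtension.{w, max (w + 1) t} lam j)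
    (F : A ⥤ C) (G : A ⥤ D) (H : C ⥤ D) :
    (∀ ε : F ⋙ H ⟶ G, Functor.IsPointwiseRan F G H ε →
      Functor.IsPointwiseRan F (G ⋙ j) (H ⋙ j)
        ((Functor.associator F H j).inv ≫ Functor.whiskerRight ε j) ∧
      ∀ (H' : C' ⥤ D') (β : i ⋙ H' ⟶ H ⋙ j), Functor.IsPointwiseRan i (H ⋙ j) H' β →
        Functor.IsPointwiseRan (F ⋙ i) (G ⋙ j) H'
          ((Functor.associator F i H').hom ≫ Functor.whiskerLeft F β ≫
            (Functor.associator F H j).inv ≫ Functor.whiskerRight ε j)) ∧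
    (EssentiallySmall.{w} A →
      ∀ η : G ⟶ F ⋙ H, Functor.IsPointwiseLan F G H η →
      Functor.IsPointwiseLan F (G ⋙ j) (H ⋙ j)
        (Functor.whiskerRight η j ≫ (Functor.associator F H j).hom) ∧
      ∀ (H' : C' ⥤ D') (β : H ⋙ j ⟶ i ⋙ H'), Functor.IsPointwiseLan i (H ⋙ j) H' β →
        Functor.IsPointwiseLan (F ⋙ i) (G ⋙ j) H'
          (Functor.whiskerRight η j ≫ (Functor.associator F H j).hom ≫
            Functor.whiskerLeft F β ≫ (Functor.associator F i H').inv)) := by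
  -- Local smallness of `C` makes `CostructuredArrow F X` essentially small in the second part.
  have := hi.locallySmall
  refine ⟨fun ε hε => ?_, fun hA η hη => ?_⟩
  · have h := hε.postcomp j (h := fun X => hj.preservesLimitsOfShape (StructuredArrow X F))
    exact ⟨h, fun H' β hβ => h.comp hβ⟩
  · have h := hη.postcomp j (h := fun X => hj.preservesColimitsOfShape (CostructuredArrow F X))
    refine ⟨h, fun H' β hβ => ?_⟩
    simpa only [Category.assoc] using h.comp hβ
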